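/- Let $\mathcal M\subset\mathbb C$ be a finite constellation, $\mathcal M\not\subseteq\{0\}$, with $\sum_{x\in\mathcal M}x^2=0$ (equivalently, for an equiprobable symbol $B$ of $\mathcal M$, the real and imaginary parts satisfy $\mathbb E[B_r^2]=\mathbb E[B_i^2]$ and $\mathbb E[B_rB_i]=0$), and let $\sigma_b^2=|\mathcal M|^{-1}\sum_{x\in\mathcal M}|x|^2$. Let $F_s>0$, and for $\mathbf b\in\mathbb C^N$ let $$u(t,\mathbf b)=\frac1{\sigma_b\sqrt N}\sum_{k=0}^{N-1}b_k\,e^{i\frac{2\pi}{N}F_skt},\qquad 0\le t<T=N/F_s .$$ Let $\rho\in[0,1]$ be rational, let $N\to\infty$ through the integers for which $j=\rho N$ is an integer, and for each $N$ let the data vector $\mathbf B=\mathbf B^{(N)}$ be uniformly distributed in $\mathcal M^N$, all $\mathbf B^{(N)}$ being defined on one probability space (with any joint distribution). Let $$\mathbf Y_j^\pm=[x_0^*,\dots,x_{j-1}^*,\pm1,X_{j+1},\dots,X_{N-1}]^T ,$$ where $X_{j+1},\dots,X_{N-1}$ are independent equiprobable signs in $\{-1,1\}$, independent of $\mathbf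 B$, and $x_0^*,\dots,x_{j-1}^*\in\{-1,1\}$ are the decided signs, which may depend on $N$ and $\mathbf B$ in any way. Let $$\hat u_r(t)=\mathrm{Re}\,u(t,\mathbf B\odot\mathbf Y_j^\pm)-\mathbb E_{\mathbf Y}[\mathrm{Re}\,u(t,\mathbf B\odot\mathbf Y_j^\pm)],\qquad \hat u_i(t)=\mathrm{Im}\,u(t,\mathbf B\odot\mathbf Y_j^\pm)-\mathbb E_{\mathbf Y}[\mathrm{Im}\,u(t,\mathbf B\odot\mathbf Y_j^\pm)],$$ where $\odot$ is the element-wise product and $\mathbb E_{\mathbf Y}$ is the expectation over the random signs for given $\mathbf B$. With $\mathrm{sinc}\,x=\sin(\pi x)/(\pi x)$, $\mathrm{sinc}\,0=1$, put $$R_{rr}(\tau)=R_{ii}(\tau)=\tfrac12\bigl(\mathrm{sinc}(2F_s\tau)-\rho\,\mathrm{sinc}(2F_s\tau\rho)\bigr),$$ $$R_{ri}(\tau)=\frac1{4\pi F_s\tau}\bigl(\cos(2\pi F_s\rho\tau)-\cos(2\pi F_s\tau)\bigr)\ \ (\tau\ne0),\qquad R_{ri}(0)=0 .$$ Fix times $t_1,\dots,t_K\ge0$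 (so that $t_m\in[0,T)$ for all large $N$). Then there is a centered jointly Gaussian vector $[x_1,y_1,\dots,x_K,y_K]^T$ with $$\mathbb E[x_mx_n]=R_{rr}(t_n-t_m),\qquad \mathbb E[y_my_n]=R_{ii}(t_n-t_m),\qquad \mathbb E[x_my_n]=R_{ri}(t_n-t_m)$$ for all $m,n$, such that, with probability one with respect to the data, for both choices of the sign $\pm$ and all decided signs, as $N\to\infty$, $$\mathbb E_{\mathbf Y}[\hat u_r(t_m)\hat u_r(t_n)]\to R_{rr}(t_n-t_m),\quad \mathbb E_{\mathbf Y}[\hat u_i(t_m)\hat u_i(t_n)]\to R_{ii}(t_n-t_m),\quad \mathbb E_{\mathbf Y}[\hat u_r(t_m)\hat u_i(t_n)]\to R_{ri}(t_n-t_m)$$ for all $m,n$, and, for given $\mathbf B$, $$[\hat u_r(t_1),\hat u_i(t_1),\dots,\hat u_r(t_K),\hat u_i(t_K)]^T\ \xrightarrow{\ d\ }\ [x_1,y_1,\dots,x_K,y_K]^T .$$ -/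

import Mathlib

open MeasureTheory ProbabilityTheory Filter Topology

noncomputable section

namespace OFDM

/-- The root mean square of an equiprobable symbol of the constellation `M`:
`σ_b = √(E|B_k|²)`.  It normalizes the signal to unit power. -/
def sigmaB (M : Finset ℂ) : ℝ :=
  Real.sqrt ((∑ x ∈ M, ‖x‖ ^ 2) / (M.card : ℝ))

/-- The baseband OFDM symbol
`u(t, b) = (σ_b √N)⁻¹ ∑_{k<N} b_k exp (i (2π/N) F_s k t)`. -/
def u (M : Finset ℂ) (Fs : ℝ) {N : ℕ} (b : Fin N → ℂ) (t : ℝ) : ℂ :=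
  1 / ((sigmaB M * Real.sqrt (N : ℝ) : ℝ) : ℂ) *
    ∑ k : Fin N, b k *
      Complex.exp (Complex.I * ((2 * Real.pi / (N : ℝ) * Fs * ((k : ℕ) : ℝ) * t : ℝ) : ℂ))

/-- The sign vector `[d_0, …, d_{j-1}, s, X_{j+1}, …, X_{N-1}]`: decided signs `d` before
position `j`, the sign `s` under trial at `j`, and the remaining signs `X` after `j`. -/
def signVector {N : ℕ} (j : ℕ) (s : ℝ) (d X : Fin N → ℝ) : Fin N → ℝ := fun k =>
  if (k : ℕ) < j then d k else if (k : ℕ) = j then s else X k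

/-- The element-wise product `b ⊙ y` of a data vector and a real sign vector. -/
def hadamard {N : ℕ} (b : Fin N → ℂ) (y : Fin N → ℝ) : Fin N → ℂ := fun k => b k * (y k : ℂ)

/-- The law of a vector of `N` independent, equiprobable signs in `{1, -1}`. -/
def signLaw (N : ℕ) : Measure (Fin N → ℝ) :=
  Measure.pi fun _ : Fin N => uniformOn ({1, -1} : Set ℝ)

instance (N : ℕ) : IsProbabilityMeasure (signLaw N) := by
  have : IsProbabilityMeasure (uniformOn ({1, -1} : Set ℝ)) :=
    isProbabilityMeasure_uniformOn (Set.toFinite _) ⟨1, by simp⟩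
  unfold signLaw
  infer_instance

/-- `û_r(t, b ⊙ Y)` as a function of the random signs `X`: the real part of the signal minus
its mean over the random signs. -/
def uHatRe (M : Finset ℂ) (Fs : ℝ) {N : ℕ} (b : Fin N → ℂ) (j : ℕ) (s : ℝ) (d : Fin N → ℝ)
    (t : ℝ) (X : Fin N → ℝ) : ℝ :=
  (u M Fs (hadamard b (signVector j s d X)) t).re
    - ∫ X', (u M Fs (hadamard b (signVector j s d X')) t).re ∂(signLaw N)

/-- `û_i(t, b ⊙ Y)` as a function of the random signs `X`: the imaginary part of the signal
minus its mean over the random signs. -/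
def uHatIm (M : Finset ℂ) (Fs : ℝ) {N : ℕ} (b : Fin N → ℂ) (j : ℕ) (s : ℝ) (d : Fin N → ℝ)
    (t : ℝ) (X : Fin N → ℝ) : ℝ :=
  (u M Fs (hadamard b (signVector j s d X)) t).im
    - ∫ X', (u M Fs (hadamard b (signVector j s d X')) t).im ∂(signLaw N)

/-- The vector `[û_r(t_1), û_i(t_1), …, û_r(t_K), û_i(t_K)]`: the coordinate `(m, 0)` is
`û_r(t_m)` and the coordinate `(m, 1)` is `û_i(t_m)`. -/
def uHatVec (M : Finset ℂ) (Fs : ℝ) {N : ℕ} (b : Fin N → ℂ) (j : ℕ) (s : ℝ) (d : Fin N → ℝ)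
    {K : ℕ} (t : Fin K → ℝ) (X : Fin N → ℝ) : EuclideanSpace ℝ (Fin K × Fin 2) :=
  WithLp.toLp 2 fun p =>
    if p.2 = 0 then uHatRe M Fs b j s d (t p.1) X else uHatIm M Fs b j s d (t p.1) X

/-- The normalized cardinal sine `sinc x = sin (π x) / (π x)`, with `sinc 0 = 1`. -/
def nsinc (x : ℝ) : ℝ := Real.sinc (Real.pi * x)

/-- The limiting covariance `R_rr = R_ii`. -/
def Rrr (Fs ρ τ : ℝ) : ℝ :=
  1 / 2 * (nsinc (2 * Fs * τ) - ρ * nsinc (2 * Fs * τ * ρ))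

/-- The limiting cross-covariance `R_ri`. -/
def Rri (Fs ρ τ : ℝ) : ℝ :=
  if τ = 0 then 0
  else 1 / 2 * (1 / (2 * Real.pi * Fs * τ)) *
    (Real.cos (2 * Real.pi * Fs * ρ * τ) - Real.cos (2 * Real.pi * Fs * τ))

/-- `N → ∞` through the integers for which `ρ N` is a natural number. -/
def alongIntegral (ρ : ℚ) : Filter ℕ :=
  atTop ⊓ 𝓟 {N : ℕ | ∃ j : ℕ, (j : ℚ) = ρ * N}

/-- The iteration index `j = ρ N`; it is the exact value `ρ N` whenever `ρ N` is a natural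
number. -/
def iter (ρ : ℚ) (N : ℕ) : ℕ := ⌊ρ * (N : ℚ)⌋₊

end OFDM

end

open scoped ENNReal NNReal

/-! For fixed data, centring removes the decided signs and the trial sign. What is left is `∑ k, X k
* coeff … k`, a linear form in the independent signs with coefficients of size `O(1/√N)`, so the
covariances over the signs are Gram sums of coefficients, free of `d` and `s`.

Since `∑ x² = 0`, the mean of `Re(xw) Re(xz)` over a symbol is `σ_b²/2 · Re(conj w · z)`. A strong
law replaces the Gram sum by its mean, a Riemann sum over the relative frequencies in `(ρ, 1]`. Its
limit `½ ∫_ρ^1` of a cosine or sine gives `Rrr` and `Rri` (`ae_tendsto_gram_coeff`). The rows may be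
jointly distributed in any way, so the strong law rests on Hoeffding's inequality and Borel–Cantelli
(`ae_tendsto_average_triangular_array`).

The characteristic function of the linear forms is a product of cosines of small arguments,
asymptotically `exp(-½ vᵀSv)`; Lévy's continuity theorem gives the Gaussian limit
(`tendstoInDistribution_linear_forms_signLaw`). -/

/-! ### Integrals against uniform measures on finite sets. -/

lemma integrableOn_count_finset {α E : Type*} [MeasurableSpace α] [MeasurableSingletonClass α]
    [NormedAddCommGroup E] (s : Finset α) (f : α → E) :
    IntegrableOn f (s : Set α) Measure.count := by
  have h : (s : Set α) = ⋃ x ∈ s, {x} := by ext; simp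
  rw [h, integrableOn_finset_iUnion]
  exact fun x _ => integrableOn_singleton (by finiteness) (by simp)

lemma integrable_uniformOn_finset {α E : Type*} [MeasurableSpace α] [MeasurableSingletonClass α]
    [NormedAddCommGroup E] (s : Finset α) (f : α → E) :
    Integrable f (uniformOn (s : Set α)) := by
  rcases s.eq_empty_or_nonempty with rfl | hs
  · simp
  · rw [uniformOn, ProbabilityTheory.cond]
    exact (integrableOn_count_finset s f).smul_measure (by simpa using hs.ne_empty)

lemma integral_uniformOn_finset {α E : Type*} [MeasurableSpace α] [MeasurableSingletonClass α]
    [NormedAddCommGroup E] [NormedSpace ℝ E] [CompleteSpace E] (s : Finset α) (f : α → E) :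
    ∫ x, f x ∂(uniformOn (s : Set α)) = (s.card : ℝ)⁻¹ • ∑ x ∈ s, f x := by
  rw [uniformOn, ProbabilityTheory.cond, integral_smul_measure,
    setIntegral_finset]
  · simp [Measure.real]
  · exact integrableOn_count_finset s f

/-! ### Strong law for triangular arrays. -/

/-- A strong law of large numbers for bounded triangular arrays with independent rows and any
joint distribution of the rows. -/
theorem ae_tendsto_average_triangular_array {Ω : Type*} [MeasurableSpace Ω] (P : Measure Ω)
    [IsProbabilityMeasure P] (X : (N : ℕ) → Fin N → Ω → ℝ) (hind : ∀ N, iIndepFun (X N) P)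
    (hX : ∀ N k, AEMeasurable (X N k) P) (C : ℝ) (hC : ∀ N k, ∀ᵐ ω ∂P, |X N k ω| ≤ C)
    (h0 : ∀ N k, ∫ ω, X N k ω ∂P = 0) :
    ∀ᵐ ω ∂P, Tendsto (fun N : ℕ => (N : ℝ)⁻¹ * ∑ k, X N k ω) atTop (𝓝 0) := by
  -- Enlarging `C` makes it positive, so that the exponent below may be divided by `C²`.
  wlog hC1 : 1 ≤ C generalizing C
  · exact this (max C 1) (fun N k => (hC N k).mono fun ω h => h.trans (le_max_left _ _))
      (le_max_right _ _)
  -- A one-sided bound for a general array, to be used for both `X` and `-X`; the levels `1/(n+1)`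
  -- keep the exceptional sets countable in number.
  have key : ∀ Y : (N : ℕ) → Fin N → Ω → ℝ, (∀ N, iIndepFun (Y N) P) →
      (∀ N k, AEMeasurable (Y N k) P) → (∀ N k, ∀ᵐ ω ∂P, |Y N k ω| ≤ C) →
      (∀ N k, ∫ ω, Y N k ω ∂P = 0) → ∀ n : ℕ,
      ∀ᵐ ω ∂P, ∀ᶠ N : ℕ in atTop, ∑ k, Y N k ω < (1 / ((n : ℝ) + 1)) * N := by
    intro Y hYi hYm hYC hY0 n
    set ε : ℝ := 1 / ((n : ℝ) + 1) with hε
    have hεpos : 0 < ε := by positivity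
    -- Hoeffding's lemma with variance proxy `C²`; the row sum then has tail `exp(-(εN)²/(2NC²))`,
    -- which is summable in `N`.
    have hsub : ∀ N k, HasSubgaussianMGF (Y N k) ((‖C - (-C)‖₊ / 2) ^ 2) P := fun N k =>
      hasSubgaussianMGF_of_mem_Icc_of_integral_eq_zero (hYm N k)
        ((hYC N k).mono fun ω h => abs_le.1 h) (hY0 N k)
    have hb : ∀ N : ℕ, P.real {ω | ε * N ≤ ∑ k, Y N k ω} ≤
        Real.exp (N * (-(ε ^ 2 / (2 * C ^ 2)))) := by
      intro N
      refine (HasSubgaussianMGF.measure_sum_ge_le_of_iIndepFun (hYi N)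
        (fun k _ => hsub N k) (by positivity)).trans (le_of_eq ?_)
      rcases Nat.eq_zero_or_pos N with rfl | hN
      · simp
      · have hNp : (0 : ℝ) < N := by exact_mod_cast hN
        congr 1
        have hc : ‖C - -C‖ = 2 * C := by
          rw [Real.norm_eq_abs, abs_of_pos (by linarith)]; ring
        rw [Finset.sum_const, Finset.card_univ, Fintype.card_fin, nsmul_eq_mul]
        push_cast
        rw [hc]
        field_simp
    have hsum : Summable fun N : ℕ => Real.exp (N * (-(ε ^ 2 / (2 * C ^ 2)))) :=
      Real.summable_exp_nat_mul_iff.2 (by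
        have : 0 < ε ^ 2 / (2 * C ^ 2) := by positivity
        linarith)
    have hfin : ∑' N : ℕ, P {ω | ε * N ≤ ∑ k, Y N k ω} ≠ ∞ := by
      refine ne_top_of_le_ne_top hsum.tsum_ofReal_ne_top (ENNReal.tsum_le_tsum fun N => ?_)
      rw [← ofReal_measureReal]
      exact ENNReal.ofReal_le_ofReal (hb N)
    -- The first Borel–Cantelli lemma needs no independence between different rows.
    filter_upwards [ae_eventually_notMem hfin] with ω hω
    filter_upwards [hω] with N hN
    simpa using hN
  have h1 := ae_all_iff.2 (key X hind hX hC h0)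
  have h2 := ae_all_iff.2 (key (fun N k ω => -X N k ω)
    (fun N => (hind N).comp (fun _ x => -x) fun _ => measurable_neg)
    (fun N k => (hX N k).neg) (fun N k => by simpa using hC N k)
    (fun N k => by rw [integral_neg, h0, neg_zero]))
  filter_upwards [h1, h2] with ω hω1 hω2
  rw [Metric.tendsto_nhds]
  intro ε hε
  obtain ⟨n, hn⟩ := exists_nat_one_div_lt hε
  filter_upwards [hω1 n, hω2 n, eventually_gt_atTop 0] with N hN1 hN2 hN
  have hNp : (0 : ℝ) < N := by exact_mod_cast hN
  rw [Finset.sum_neg_distrib] at hN2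
  have : |∑ k, X N k ω| < (1 / ((n : ℝ) + 1)) * N := abs_lt.2 ⟨by linarith, hN1⟩
  rw [Real.dist_eq, sub_zero, abs_mul, abs_inv, abs_of_pos hNp, inv_mul_lt_iff₀ hNp]
  nlinarith

/-! ### Riemann sums over part of the grid. -/

/-- Riemann sums of a Lipschitz function over the prefix `k < n` of the grid `k / N`. -/
lemma abs_riemann_sum_prefix_sub_integral_le {f : ℝ → ℝ} {L : ℝ≥0} (hf : LipschitzWith L f)
    {N : ℕ} (hN : 0 < N) (n : ℕ) :
    |(N : ℝ)⁻¹ * ∑ k ∈ Finset.range n, f (k / N) - ∫ x in (0 : ℝ)..(n / N), f x|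
      ≤ n * (L / N ^ 2) := by
  have hNp : (0 : ℝ) < N := by exact_mod_cast hN
  have hint : ∀ a b, IntervalIntegrable f volume a b := fun a b =>
    hf.continuous.intervalIntegrable a b
  induction n with
  | zero => simp
  | succ n ih =>
    -- On a cell of length `1/N` the function stays within `L/N` of its value at the left endpoint.
    have hstep : |(N : ℝ)⁻¹ * f (n / N) - ∫ x in (n / N : ℝ)..((n + 1 : ℕ) / N), f x|
        ≤ L / N ^ 2 := by
      have hlen : ((n + 1 : ℕ) / N : ℝ) - n / N = (N : ℝ)⁻¹ := by
        push_cast; field_simp; ring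
      have hle : (n / N : ℝ) ≤ (n + 1 : ℕ) / N := by
        have : (0 : ℝ) < (N : ℝ)⁻¹ := by positivity
        linarith
      have h1 : (N : ℝ)⁻¹ * f (n / N) = ∫ x in (n / N : ℝ)..((n + 1 : ℕ) / N), f (n / N) := by
        rw [intervalIntegral.integral_const, hlen, smul_eq_mul]
      rw [h1, ← intervalIntegral.integral_sub (by simp) (hint _ _), ← Real.norm_eq_abs]
      refine (intervalIntegral.norm_integral_le_of_norm_le_const (C := L * (N : ℝ)⁻¹) ?_).trans
        (le_of_eq ?_)
      · intro x hx
        rw [Set.uIoc_of_le hle] at hx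
        rw [← dist_eq_norm]
        refine (hf.dist_le_mul _ _).trans ?_
        gcongr
        rw [dist_comm, Real.dist_eq, abs_of_pos (by linarith [hx.1])]
        linarith [hx.2]
      · rw [hlen, abs_of_pos (by positivity)]; field_simp
    rw [Finset.sum_range_succ, ← intervalIntegral.integral_add_adjacent_intervals
      (hint 0 (n / N)) (hint (n / N) ((n + 1 : ℕ) / N))]
    calc _ = |((N : ℝ)⁻¹ * ∑ k ∈ Finset.range n, f (k / N) - ∫ x in (0 : ℝ)..(n / N), f x)
          + ((N : ℝ)⁻¹ * f (n / N) - ∫ x in (n / N : ℝ)..((n + 1 : ℕ) / N), f x)| := by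
            congr 1; ring
      _ ≤ _ := (abs_add_le _ _).trans (add_le_add ih hstep)
      _ = _ := by push_cast; ring

lemma tendsto_riemann_sum_prefix {f : ℝ → ℝ} {L : ℝ≥0} (hf : LipschitzWith L f) {n : ℕ → ℕ}
    (hn : ∀ N, n N ≤ N) {a : ℝ} (ha : Tendsto (fun N : ℕ => (n N : ℝ) / N) atTop (𝓝 a)) :
    Tendsto (fun N : ℕ => (N : ℝ)⁻¹ * ∑ k ∈ Finset.range (n N), f (k / N)) atTop
      (𝓝 (∫ x in (0 : ℝ)..a, f x)) := by
  have hI : Tendsto (fun N : ℕ => ∫ x in (0 : ℝ)..((n N : ℝ) / N), f x) atTop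
      (𝓝 (∫ x in (0 : ℝ)..a, f x)) :=
    ((intervalIntegral.continuous_primitive (fun _ _ => hf.continuous.intervalIntegrable _ _) 0
      ).tendsto a).comp ha
  have hd : Tendsto (fun N : ℕ => (N : ℝ)⁻¹ * ∑ k ∈ Finset.range (n N), f (k / N)
      - ∫ x in (0 : ℝ)..((n N : ℝ) / N), f x) atTop (𝓝 0) := by
    refine squeeze_zero_norm' (a := fun N : ℕ => (L : ℝ) / N) ?_
      (tendsto_const_div_atTop_nhds_zero_nat _)
    filter_upwards [eventually_gt_atTop 0] with N hN
    have hNp : (0 : ℝ) < N := by exact_mod_cast hN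
    refine (abs_riemann_sum_prefix_sub_integral_le hf hN (n N)).trans ?_
    have : (n N : ℝ) ≤ N := by exact_mod_cast hn N
    calc (n N : ℝ) * ((L : ℝ) / N ^ 2) ≤ N * ((L : ℝ) / N ^ 2) := by gcongr
      _ = (L : ℝ) / N := by field_simp
  simpa using hd.add hI

lemma tendsto_riemann_sum_suffix {f : ℝ → ℝ} {L : ℝ≥0} (hf : LipschitzWith L f) {j : ℕ → ℕ}
    {a : ℝ} (ha1 : a ≤ 1) (ha : Tendsto (fun N : ℕ => (j N : ℝ) / N) atTop (𝓝 a)) :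
    Tendsto (fun N : ℕ => (N : ℝ)⁻¹ * ∑ k : Fin N, if j N < k then f (k / N) else 0) atTop
      (𝓝 (∫ x in a..1, f x)) := by
  have h1 : Tendsto (fun N : ℕ => (N : ℝ) / N) atTop (𝓝 1) := by
    refine tendsto_const_nhds.congr' ?_
    filter_upwards [eventually_gt_atTop 0] with N hN
    rw [div_self (by positivity)]
  -- The condition `j N < k` omits a prefix of `j N + 1` terms; the minimum with `N` matters when `j
  -- N ≥ N`, as happens for density `1`.
  have hm : Tendsto (fun N : ℕ => ((min (j N + 1) N : ℕ) : ℝ) / N) atTop (𝓝 a) := by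
    have h2 : Tendsto (fun N : ℕ => min ((j N : ℝ) / N + 1 / N) ((N : ℝ) / N)) atTop
        (𝓝 (min (a + 0) 1)) :=
      (ha.add (tendsto_const_div_atTop_nhds_zero_nat 1)).min h1
    rw [add_zero, min_eq_left ha1] at h2
    refine h2.congr fun N => ?_
    rw [← add_div, min_div_div_right (Nat.cast_nonneg N)]
    push_cast
    rfl
  have h := (tendsto_riemann_sum_prefix hf (fun N => le_rfl) h1).sub
    (tendsto_riemann_sum_prefix hf (fun N => min_le_right (j N + 1) N) hm)
  rw [intervalIntegral.integral_interval_sub_left (hf.continuous.intervalIntegrable _ _)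
    (hf.continuous.intervalIntegrable _ _)] at h
  refine h.congr fun N => ?_
  rw [← mul_sub, Fin.sum_univ_eq_sum_range (fun k => if j N < k then f (k / N) else 0) N,
    ← Finset.sum_Ico_eq_sub _ (min_le_right (j N + 1) N), ← Finset.sum_filter]
  congr 2
  ext k
  simp only [Finset.mem_Ico, Finset.mem_filter, Finset.mem_range]
  omega

/-! ### Products of cosines of small arguments. -/

/-- The factors are exchanged one at a time, all others being bounded by `1`. -/
lemma abs_prod_sub_prod_le_sum {ι : Type*} (s : Finset ι) {f g : ι → ℝ}
    (hf : ∀ i ∈ s, |f i| ≤ 1) (hg : ∀ i ∈ s, |g i| ≤ 1) :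
    |∏ i ∈ s, f i - ∏ i ∈ s, g i| ≤ ∑ i ∈ s, |f i - g i| := by
  classical
  induction s using Finset.induction_on with
  | empty => simp
  | insert a s ha ih =>
    simp only [Finset.mem_insert, forall_eq_or_imp] at hf hg
    rw [Finset.prod_insert ha, Finset.prod_insert ha, Finset.sum_insert ha]
    have hp : |∏ i ∈ s, f i| ≤ 1 := by
      rw [Finset.abs_prod]
      exact Finset.prod_le_one (fun _ _ => abs_nonneg _) hf.2
    calc |f a * ∏ i ∈ s, f i - g a * ∏ i ∈ s, g i|
        = |(f a - g a) * ∏ i ∈ s, f i + g a * (∏ i ∈ s, f i - ∏ i ∈ s, g i)| := by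
          congr 1; ring
      _ ≤ |f a - g a| * 1 + 1 * |∏ i ∈ s, f i - ∏ i ∈ s, g i| := by
          refine (abs_add_le _ _).trans ?_
          rw [abs_mul, abs_mul]
          gcongr
          exact hg.1
      _ ≤ _ := by rw [mul_one, one_mul]; gcongr; exact ih hf.2 hg.2

/-- Both functions agree with `1 - x²/2` up to fourth order, with errors at most `5x⁴/96` and
`x⁴/4`. -/
lemma abs_cos_sub_exp_le {x : ℝ} (hx : |x| ≤ 1) :
    |Real.cos x - Real.exp (-(x ^ 2 / 2))| ≤ x ^ 4 := by
  have h1 := Real.cos_bound hx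
  have hx2 : x ^ 2 ≤ 1 := by rw [← sq_abs]; nlinarith [abs_nonneg x]
  have h2 := Real.abs_exp_sub_one_sub_id_le (x := -(x ^ 2 / 2)) (by
    rw [abs_neg, abs_of_nonneg (by positivity)]; linarith)
  have hx4 : |x| ^ 4 = x ^ 4 := by
    rw [← abs_pow, abs_of_nonneg (by positivity)]
  rw [hx4] at h1
  rw [abs_le] at *
  constructor <;> nlinarith [h1.1, h1.2, h2.1, h2.2, sq_nonneg (x ^ 2)]

/-- Replacing each cosine by a Gaussian factor costs at most `(C/√N)⁴`, hence `C⁴/N` over all `N`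
factors; the Gaussian product depends only on the sum of squares. -/
lemma tendsto_prod_cos {a : (N : ℕ) → Fin N → ℝ} {C v : ℝ}
    (ha : ∀ N k, |a N k| ≤ C / √N)
    (hv : Tendsto (fun N => ∑ k, a N k ^ 2) atTop (𝓝 v)) :
    Tendsto (fun N => ∏ k, Real.cos (a N k)) atTop (𝓝 (Real.exp (-(v / 2)))) := by
  have he : Tendsto (fun N => ∏ k, Real.exp (-(a N k ^ 2 / 2))) atTop
      (𝓝 (Real.exp (-(v / 2)))) := by
    refine ((Real.continuous_exp.tendsto _).comp (hv.div_const 2).neg).congr fun N => ?_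
    simp only [Function.comp_apply]
    rw [← Real.exp_sum, Finset.sum_neg_distrib, Finset.sum_div]
  have hsmall : ∀ᶠ N : ℕ in atTop, C / √N ≤ 1 := by
    have : Tendsto (fun N : ℕ => C / √(N : ℝ)) atTop (𝓝 0) :=
      (Real.tendsto_sqrt_atTop.comp tendsto_natCast_atTop_atTop).const_div_atTop C
    filter_upwards [this.eventually (gt_mem_nhds one_pos)] with N hN using hN.le
  have hd : Tendsto (fun N => ∏ k, Real.cos (a N k) - ∏ k, Real.exp (-(a N k ^ 2 / 2))) atTop
      (𝓝 0) := by
    refine squeeze_zero_norm' (a := fun N : ℕ => C ^ 4 / N) ?_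
      (tendsto_const_div_atTop_nhds_zero_nat _)
    filter_upwards [hsmall, eventually_gt_atTop 0] with N hN hN0
    have hNp : (0 : ℝ) < N := by exact_mod_cast hN0
    calc _ ≤ ∑ k, |Real.cos (a N k) - Real.exp (-(a N k ^ 2 / 2))| :=
          abs_prod_sub_prod_le_sum _ (fun k _ => Real.abs_cos_le_one _) (fun k _ => by
            rw [abs_of_pos (Real.exp_pos _)]
            exact Real.exp_le_one_iff.2 (by have := sq_nonneg (a N k); linarith))
      _ ≤ ∑ k : Fin N, (C / √N) ^ 4 := Finset.sum_le_sum fun k _ => by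
          refine (abs_cos_sub_exp_le ((ha N k).trans hN)).trans ?_
          rw [← abs_of_nonneg (by positivity : 0 ≤ a N k ^ 4), abs_pow]
          exact pow_le_pow_left₀ (abs_nonneg _) (ha N k) 4
      _ = C ^ 4 / N := by
          rw [Finset.sum_const, Finset.card_univ, Fintype.card_fin, nsmul_eq_mul, div_pow,
            show √(N : ℝ) ^ 4 = (√(N : ℝ) ^ 2) ^ 2 by ring, Real.sq_sqrt hNp.le]
          field_simp
  simpa using hd.add he

/-! ### Random signs and the signal as a linear form in them. -/

namespace OFDM

instance : IsProbabilityMeasure (uniformOn ({1, -1} : Set ℝ)) :=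
  isProbabilityMeasure_uniformOn (Set.toFinite _) ⟨1, by simp⟩

lemma integrable_sign {E : Type*} [NormedAddCommGroup E] (f : ℝ → E) :
    Integrable f (uniformOn ({1, -1} : Set ℝ)) := by
  simpa using integrable_uniformOn_finset ({1, -1} : Finset ℝ) f

lemma integral_sign {E : Type*} [NormedAddCommGroup E] [NormedSpace ℝ E] [CompleteSpace E]
    (f : ℝ → E) : ∫ x, f x ∂(uniformOn ({1, -1} : Set ℝ)) = (2 : ℝ)⁻¹ • (f 1 + f (-1)) := by
  have h : (1 : ℝ) ∉ ({-1} : Finset ℝ) := by norm_num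
  have := integral_uniformOn_finset ({1, -1} : Finset ℝ) f
  rw [Finset.sum_insert h, Finset.sum_singleton, Finset.card_insert_of_notMem h,
    Finset.card_singleton] at this
  simpa [one_add_one_eq_two] using this

lemma integrable_signLaw_prod {N : ℕ} {𝕜 : Type*} [RCLike 𝕜] (f : Fin N → ℝ → 𝕜) :
    Integrable (fun X : Fin N → ℝ => ∏ k, f k (X k)) (signLaw N) :=
  Integrable.fintype_prod fun k => integrable_sign (f k)

lemma integral_signLaw_prod {N : ℕ} {𝕜 : Type*} [RCLike 𝕜] (f : Fin N → ℝ → 𝕜) :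
    ∫ X, ∏ k, f k (X k) ∂(signLaw N) = ∏ k, (2 : ℝ)⁻¹ • (f k 1 + f k (-1)) := by
  rw [signLaw, integral_fintype_prod_eq_prod]
  simp_rw [integral_sign]

/-- In this form a coordinate is a product over all coordinates, to which `integral_signLaw_prod`
applies. -/
lemma eval_eq_prod {N : ℕ} (k : Fin N) (X : Fin N → ℝ) :
    X k = ∏ i, if i = k then X i else 1 := by
  simp

lemma eval_mul_eval_eq_prod {N : ℕ} (k l : Fin N) (X : Fin N → ℝ) :
    X k * X l = ∏ i, (if i = k then X i else 1) * (if i = l then X i else 1) := by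
  rw [Finset.prod_mul_distrib]; simp

lemma integrable_signLaw_eval {N : ℕ} (k : Fin N) :
    Integrable (fun X : Fin N → ℝ => X k) (signLaw N) := by
  simp_rw [eval_eq_prod k]
  exact integrable_signLaw_prod fun i x => if i = k then x else 1

lemma integral_signLaw_eval {N : ℕ} (k : Fin N) : ∫ X, X k ∂(signLaw N) = 0 := by
  simp_rw [eval_eq_prod k]
  rw [integral_signLaw_prod fun i x => if i = k then x else 1]
  exact Finset.prod_eq_zero (Finset.mem_univ k) (by simp)

lemma integrable_signLaw_eval_mul_eval {N : ℕ} (k l : Fin N) :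
    Integrable (fun X : Fin N → ℝ => X k * X l) (signLaw N) := by
  simp_rw [eval_mul_eval_eq_prod k l]
  exact integrable_signLaw_prod fun i x => (if i = k then x else 1) * (if i = l then x else 1)

lemma integral_signLaw_eval_mul_eval {N : ℕ} (k l : Fin N) :
    ∫ X, X k * X l ∂(signLaw N) = if k = l then 1 else 0 := by
  simp_rw [eval_mul_eval_eq_prod k l]
  rw [integral_signLaw_prod fun i x => (if i = k then x else 1) * (if i = l then x else 1)]
  split_ifs with h
  · subst h
    refine Finset.prod_eq_one fun i _ => ?_
    by_cases hi : i = k <;> simp [hi] <;> norm_num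
  · exact Finset.prod_eq_zero (Finset.mem_univ k) (by simp [h])

lemma integral_signLaw_linear_mul_linear {N : ℕ} (a c : Fin N → ℝ) :
    ∫ X, (∑ k, X k * a k) * (∑ k, X k * c k) ∂(signLaw N) = ∑ k, a k * c k := by
  have h : ∀ X : Fin N → ℝ, (∑ k, X k * a k) * (∑ k, X k * c k) =
      ∑ k, ∑ l, (X k * X l) * (a k * c l) := fun X => by
    rw [Finset.sum_mul_sum]
    exact Finset.sum_congr rfl fun k _ => Finset.sum_congr rfl fun l _ => by ring
  simp_rw [h]
  rw [integral_finsetSum _ fun k _ => integrable_finsetSum _ fun l _ =>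
    (integrable_signLaw_eval_mul_eval k l).mul_const _]
  refine Finset.sum_congr rfl fun k _ => ?_
  rw [integral_finsetSum _ fun l _ => (integrable_signLaw_eval_mul_eval k l).mul_const _]
  simp_rw [integral_mul_const, integral_signLaw_eval_mul_eval]
  simp

/-- Centring a linear form of the sign vector leaves the linear form in the random signs. -/
lemma signVector_linear_sub_integral {N : ℕ} (j : ℕ) (s : ℝ) (d X a : Fin N → ℝ) :
    ∑ k, signVector j s d X k * a k - ∫ X', ∑ k, signVector j s d X' k * a k ∂(signLaw N)
      = ∑ k : Fin N, X k * (if j < k then a k else 0) := by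
  -- Setting the random signs to `0` isolates the deterministic part, which cancels on centring.
  have hsplit : ∀ X' : Fin N → ℝ, ∑ k, signVector j s d X' k * a k =
      ∑ k, signVector j s d 0 k * a k + ∑ k : Fin N, X' k * (if j < k then a k else 0) := by
    intro X'
    rw [← Finset.sum_add_distrib]
    refine Finset.sum_congr rfl fun k _ => ?_
    unfold signVector
    rcases lt_trichotomy (k : ℕ) j with h | h | h
    · simp [h, h.le]
    · simp [h]
    · simp [h, h.not_gt, h.ne']
  have hi : ∀ k : Fin N, Integrable
      (fun X' : Fin N → ℝ => X' k * (if j < k then a k else 0)) (signLaw N) := fun k =>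
    (integrable_signLaw_eval k).mul_const _
  rw [hsplit X, integral_congr_ae (ae_of_all _ hsplit), integral_add (integrable_const _) (integrable_finsetSum _ fun k _ => hi k),
    integral_finsetSum _ fun k _ => hi k]
  simp_rw [integral_mul_const, integral_signLaw_eval]
  simp

/-- The exponential factors over the coordinates, and an equiprobable sign turns `exp(iXθ)` into
`cos θ`. -/
lemma charFun_signLaw_map {N : ℕ} {ι : Type*} [Fintype ι] (a : ι → Fin N → ℝ)
    (V : (Fin N → ℝ) → EuclideanSpace ℝ ι) (hV : ∀ X p, V X p = ∑ k, X k * a p k)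
    (hVm : Measurable V) (v : EuclideanSpace ℝ ι) :
    charFun ((signLaw N).map V) v = ((∏ k, Real.cos (∑ p, v p * a p k) : ℝ) : ℂ) := by
  rw [charFun_apply, integral_map hVm.aemeasurable (by fun_prop)]
  have h : ∀ X : Fin N → ℝ, Complex.exp ((inner ℝ (V X) v : ℝ) * Complex.I) =
      ∏ k, Complex.exp ((X k * ∑ p, v p * a p k : ℝ) * Complex.I) := by
    intro X
    rw [← Complex.exp_sum, ← Finset.sum_mul, ← Complex.ofReal_sum]
    congr 3
    rw [PiLp.inner_apply]
    simp_rw [hV, Finset.mul_sum]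
    rw [Finset.sum_comm]
    refine Finset.sum_congr rfl fun p _ => ?_
    simp only [RCLike.inner_apply, conj_trivial, Finset.mul_sum]
    exact Finset.sum_congr rfl fun k _ => by ring
  simp_rw [h]
  rw [integral_signLaw_prod fun k x => Complex.exp ((x * ∑ p, v p * a p k : ℝ) * Complex.I)]
  push_cast
  refine Finset.prod_congr rfl fun k _ => ?_
  rw [Complex.cos, Complex.real_smul]
  push_cast
  ring_nf

/-- The time evolution `exp (2 π i F_s t x)` at relative frequency `x`, turned by `-π/2` for the
imaginary component `c = 1`. -/
noncomputable def phasor (Fs t : ℝ) (c : Fin 2) (x : ℝ) : ℂ :=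
  (if c = 0 then 1 else -Complex.I) * Complex.exp (((2 * Real.pi * Fs * t * x : ℝ) : ℂ) * Complex.I)

/-- The coefficient of the `k`-th sign in the coordinate `p` of `uHatVec`. -/
noncomputable def coeff (M : Finset ℂ) (Fs : ℝ) {N : ℕ} (b : Fin N → ℂ) (j : ℕ) {K : ℕ}
    (t : Fin K → ℝ) (p : Fin K × Fin 2) (k : Fin N) : ℝ :=
  if j < k then (b k * phasor Fs (t p.1) p.2 ((k : ℕ) / (N : ℝ))).re / (sigmaB M * √(N : ℝ))
  else 0

lemma norm_phasor (Fs t : ℝ) (c : Fin 2) (x : ℝ) : ‖phasor Fs t c x‖ = 1 := by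
  rw [phasor, norm_mul, Complex.norm_exp_ofReal_mul_I, mul_one]
  split_ifs <;> simp

lemma u_hadamard (M : Finset ℂ) (Fs : ℝ) {N : ℕ} (b : Fin N → ℂ) (y : Fin N → ℝ) (t : ℝ) :
    u M Fs (hadamard b y) t = ∑ k, ((y k : ℝ) : ℂ) *
      (b k * phasor Fs t 0 ((k : ℕ) / (N : ℝ)) / ((sigmaB M * √(N : ℝ) : ℝ) : ℂ)) := by
  rw [u, Finset.mul_sum]
  refine Finset.sum_congr rfl fun k _ => ?_
  have h : Complex.I * ((2 * Real.pi / (N : ℝ) * Fs * ((k : ℕ) : ℝ) * t : ℝ) : ℂ) =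
      ((2 * Real.pi * Fs * t * ((k : ℕ) / (N : ℝ)) : ℝ) : ℂ) * Complex.I := by
    push_cast; ring
  rw [h, hadamard, phasor, if_pos rfl]
  ring

lemma uHatRe_eq (M : Finset ℂ) (Fs : ℝ) {N : ℕ} (b : Fin N → ℂ) (j : ℕ) (s : ℝ) (d : Fin N → ℝ)
    {K : ℕ} (t : Fin K → ℝ) (m : Fin K) (X : Fin N → ℝ) :
    uHatRe M Fs b j s d (t m) X = ∑ k, X k * coeff M Fs b j t (m, 0) k := by
  simp_rw [uHatRe, u_hadamard, Complex.re_sum, Complex.re_ofReal_mul, Complex.div_ofReal_re,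
    signVector_linear_sub_integral, coeff]

lemma uHatIm_eq (M : Finset ℂ) (Fs : ℝ) {N : ℕ} (b : Fin N → ℂ) (j : ℕ) (s : ℝ) (d : Fin N → ℝ)
    {K : ℕ} (t : Fin K → ℝ) (m : Fin K) (X : Fin N → ℝ) :
    uHatIm M Fs b j s d (t m) X = ∑ k, X k * coeff M Fs b j t (m, 1) k := by
  -- As `Re(-iz) = Im z`, one real-part formula in `coeff` serves both components.
  have h : ∀ x : ℝ, ∀ z : ℂ, (z * phasor Fs (t m) 1 x).re = (z * phasor Fs (t m) 0 x).im := by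
    intro x z
    simp [phasor]
    ring
  simp_rw [uHatIm, u_hadamard, Complex.im_sum, Complex.im_ofReal_mul, Complex.div_ofReal_im,
    signVector_linear_sub_integral, coeff, h]

lemma uHatVec_apply (M : Finset ℂ) (Fs : ℝ) {N : ℕ} (b : Fin N → ℂ) (j : ℕ) (s : ℝ)
    (d : Fin N → ℝ) {K : ℕ} (t : Fin K → ℝ) (X : Fin N → ℝ) (p : Fin K × Fin 2) :
    uHatVec M Fs b j s d t X p = ∑ k, X k * coeff M Fs b j t p k := by
  obtain ⟨m, c⟩ := p
  fin_cases c
  · simpa [uHatVec] using uHatRe_eq M Fs b j s d t m X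
  · simpa [uHatVec] using uHatIm_eq M Fs b j s d t m X

lemma measurable_uHatVec (M : Finset ℂ) (Fs : ℝ) {N : ℕ} (b : Fin N → ℂ) (j : ℕ) (s : ℝ)
    (d : Fin N → ℝ) {K : ℕ} (t : Fin K → ℝ) : Measurable (uHatVec M Fs b j s d t) := by
  have h : uHatVec M Fs b j s d t = fun X => WithLp.toLp 2 fun p =>
      ∑ k, X k * coeff M Fs b j t p k := by
    ext X p
    exact uHatVec_apply M Fs b j s d t X p
  rw [h]
  fun_prop

end OFDM

/-! ### Gaussian limit of linear forms in signs. -/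

section Gaussian

variable {ι : Type*} [Fintype ι]

lemma sum_sq_linear_combination {κ : Type*} [Fintype κ] (a : ι → κ → ℝ) (v : ι → ℝ) :
    ∑ k, (∑ p, v p * a p k) ^ 2 = ∑ p, ∑ q, v p * v q * ∑ k, a p k * a q k := by
  simp_rw [sq, Finset.sum_mul_sum, Finset.mul_sum]
  rw [Finset.sum_comm]
  refine Finset.sum_congr rfl fun p _ => ?_
  rw [Finset.sum_comm]
  exact Finset.sum_congr rfl fun q _ => Finset.sum_congr rfl fun k _ => by ring

lemma dotProduct_mulVec_eq_sum (S : Matrix ι ι ℝ) (v : ι → ℝ) :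
    v ⬝ᵥ S.mulVec v = ∑ p, ∑ q, v p * v q * S p q := by
  simp_rw [dotProduct, Matrix.mulVec, dotProduct, Finset.mul_sum]
  exact Finset.sum_congr rfl fun p _ => Finset.sum_congr rfl fun q _ => by ring

lemma tendsto_sum_sq_linear_combination {a : (N : ℕ) → ι → Fin N → ℝ} {S : Matrix ι ι ℝ}
    (hS : ∀ p q, Tendsto (fun N => ∑ k, a N p k * a N q k) atTop (𝓝 (S p q))) (v : ι → ℝ) :
    Tendsto (fun N => ∑ k, (∑ p, v p * a N p k) ^ 2) atTop (𝓝 (v ⬝ᵥ S.mulVec v)) := by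
  simp_rw [sum_sq_linear_combination, dotProduct_mulVec_eq_sum]
  exact tendsto_finsetSum _ fun p _ => tendsto_finsetSum _ fun q _ => (hS p q).const_mul _

/-- A limit of Gram matrices is positive semidefinite. -/
lemma posSemidef_of_tendsto_gram {a : (N : ℕ) → ι → Fin N → ℝ} {S : Matrix ι ι ℝ}
    (hS : ∀ p q, Tendsto (fun N => ∑ k, a N p k * a N q k) atTop (𝓝 (S p q))) :
    S.PosSemidef := by
  refine .of_dotProduct_mulVec_nonneg ?_ fun v => ?_
  · ext p q
    refine tendsto_nhds_unique (hS q p) ((hS p q).congr fun N => ?_)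
    exact Finset.sum_congr rfl fun k _ => mul_comm _ _
  · rw [star_trivial]
    exact ge_of_tendsto' (tendsto_sum_sq_linear_combination hS v) fun N =>
      Finset.sum_nonneg fun k _ => sq_nonneg _

variable [DecidableEq ι]

/-- A central limit theorem for vectors of uniformly small linear forms in independent signs. -/
theorem tendstoInDistribution_linear_forms_signLaw {a : (N : ℕ) → ι → Fin N → ℝ}
    {S : Matrix ι ι ℝ} {C : ℝ} {l : Filter ℕ} (hl : l ≤ atTop)
    (ha : ∀ N p k, |a N p k| ≤ C / √N)
    (hS : ∀ p q, Tendsto (fun N => ∑ k, a N p k * a N q k) atTop (𝓝 (S p q)))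
    (V : (N : ℕ) → (Fin N → ℝ) → EuclideanSpace ℝ ι)
    (hV : ∀ N X p, V N X p = ∑ k, X k * a N p k) (hVm : ∀ N, Measurable (V N)) :
    TendstoInDistribution V l (id : EuclideanSpace ℝ ι → EuclideanSpace ℝ ι)
      (fun N => OFDM.signLaw N) (multivariateGaussian 0 S) where
  forall_aemeasurable N := (hVm N).aemeasurable
  tendsto := by
    -- Lévy's continuity theorem, applied along all `N` and then restricted to `l`.
    refine (ProbabilityMeasure.tendsto_iff_tendsto_charFun.2 fun v => ?_).mono_left hl
    simp only [ProbabilityMeasure.coe_mk, Measure.map_id,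
      charFun_multivariateGaussian (posSemidef_of_tendsto_gram hS)]
    have hb : ∀ (N : ℕ) (k : Fin N), |∑ p, v p * a N p k| ≤ (∑ p, |v p|) * C / √N := by
      intro N k
      rw [mul_div_assoc, Finset.sum_mul]
      refine (Finset.abs_sum_le_sum_abs _ _).trans (Finset.sum_le_sum fun p _ => ?_)
      rw [abs_mul]
      exact mul_le_mul_of_nonneg_left (ha N p k) (abs_nonneg _)
    have h := (Complex.continuous_ofReal.tendsto _).comp
      (tendsto_prod_cos hb (tendsto_sum_sq_linear_combination hS (fun p => v p)))
    convert h using 2 with N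
    · exact OFDM.charFun_signLaw_map (a N) (V N) (hV N) (hVm N) v
    · simp

lemma integral_eval_multivariateGaussian_zero (S : Matrix ι ι ℝ) (p : ι) :
    ∫ z, z p ∂(multivariateGaussian 0 S) = 0 := by
  have h := (EuclideanSpace.proj (𝕜 := ℝ) p).integral_comp_id_comm
    (IsGaussian.integrable_id (μ := multivariateGaussian 0 S))
  simpa using h

lemma integral_eval_mul_eval_multivariateGaussian_zero {S : Matrix ι ι ℝ} (hS : S.PosSemidef)
    (p q : ι) : ∫ z, z p * z q ∂(multivariateGaussian 0 S) = S p q := by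
  rw [← covariance_eval_multivariateGaussian (μ := 0) hS p q, covariance]
  simp [integral_eval_multivariateGaussian_zero]

end Gaussian

/-! ### The limiting covariance. -/

namespace OFDM

/-- The covariance kernel of two phasors at relative frequency `x`. -/
noncomputable def kernel (Fs : ℝ) {K : ℕ} (t : Fin K → ℝ) (p q : Fin K × Fin 2) (x : ℝ) : ℝ :=
  ((starRingEnd ℂ) (phasor Fs (t p.1) p.2 x) * phasor Fs (t q.1) q.2 x).re

/-- The limiting covariance matrix. -/
noncomputable def limitCov (Fs ρ : ℝ) {K : ℕ} (t : Fin K → ℝ) :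
    Matrix (Fin K × Fin 2) (Fin K × Fin 2) ℝ :=
  fun p q => 1 / 2 * ∫ x in ρ..1, kernel Fs t p q x

lemma conj_exp_mul_exp (a b : ℝ) :
    (starRingEnd ℂ) (Complex.exp ((a : ℂ) * Complex.I)) * Complex.exp ((b : ℂ) * Complex.I) =
      Complex.exp (((b - a : ℝ) : ℂ) * Complex.I) := by
  rw [← Complex.exp_conj, ← Complex.exp_add]
  congr 1
  simp
  ring

lemma kernel_self (Fs : ℝ) {K : ℕ} (t : Fin K → ℝ) (m n : Fin K) (c : Fin 2) (x : ℝ) :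
    kernel Fs t (m, c) (n, c) x = Real.cos (2 * Real.pi * Fs * (t n - t m) * x) := by
  have h : kernel Fs t (m, c) (n, c) x = ((starRingEnd ℂ) (Complex.exp
      (((2 * Real.pi * Fs * t m * x : ℝ) : ℂ) * Complex.I)) * Complex.exp
      (((2 * Real.pi * Fs * t n * x : ℝ) : ℂ) * Complex.I)).re := by
    unfold kernel phasor
    fin_cases c
    · simp
    · simp only [map_mul]
      congr 1
      rw [mul_mul_mul_comm]
      simp
  rw [h, conj_exp_mul_exp, Complex.exp_ofReal_mul_I_re]
  ring_nf

lemma kernel_zero_one (Fs : ℝ) {K : ℕ} (t : Fin K → ℝ) (m n : Fin K) (x : ℝ) :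
    kernel Fs t (m, 0) (n, 1) x = Real.sin (2 * Real.pi * Fs * (t n - t m) * x) := by
  have h : kernel Fs t (m, 0) (n, 1) x = ((starRingEnd ℂ) (Complex.exp
      (((2 * Real.pi * Fs * t m * x : ℝ) : ℂ) * Complex.I)) * Complex.exp
      (((2 * Real.pi * Fs * t n * x : ℝ) : ℂ) * Complex.I)).im := by
    unfold kernel phasor
    simp only [if_pos, one_mul, one_ne_zero, if_false]
    rw [mul_left_comm]
    simp
  rw [h, conj_exp_mul_exp, Complex.exp_ofReal_mul_I_im]
  ring_nf

lemma kernel_comm (Fs : ℝ) {K : ℕ} (t : Fin K → ℝ) (p q : Fin K × Fin 2) (x : ℝ) :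
    kernel Fs t p q x = kernel Fs t q p x := by
  unfold kernel
  simp
  ring

/-- The kernel is a cosine or sine of a linear function of `x`; the order `(1, 0)` reduces to `(0,
1)` by symmetry. -/
lemma exists_lipschitzWith_kernel (Fs : ℝ) {K : ℕ} (t : Fin K → ℝ) (p q : Fin K × Fin 2) :
    ∃ L : ℝ≥0, LipschitzWith L (kernel Fs t p q) := by
  have hs : ∀ m n : Fin K, ∃ L : ℝ≥0, LipschitzWith L (kernel Fs t (m, 0) (n, 1)) := by
    intro m n
    rw [funext (kernel_zero_one Fs t m n)]
    exact ⟨_, Real.lipschitzWith_sin.comp (lipschitzWith_smul (2 * Real.pi * Fs * (t n - t m)))⟩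
  have hc : ∀ (m n : Fin K) (c : Fin 2), ∃ L : ℝ≥0,
      LipschitzWith L (kernel Fs t (m, c) (n, c)) := by
    intro m n c
    rw [funext (kernel_self Fs t m n c)]
    exact ⟨_, Real.lipschitzWith_cos.comp (lipschitzWith_smul (2 * Real.pi * Fs * (t n - t m)))⟩
  obtain ⟨m, c⟩ := p
  obtain ⟨n, e⟩ := q
  fin_cases c <;> fin_cases e
  · exact hc m n 0
  · exact hs m n
  · rw [show kernel Fs t _ _ = _ from funext (kernel_comm Fs t _ _)]
    exact hs n m
  · exact hc m n 1

lemma integral_zero_cos_mul (θ a : ℝ) :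
    ∫ x in (0 : ℝ)..a, Real.cos (θ * x) = a * Real.sinc (θ * a) := by
  rcases eq_or_ne θ 0 with rfl | hθ
  · simp
  rcases eq_or_ne a 0 with rfl | ha
  · simp
  rw [intervalIntegral.integral_comp_mul_left _ hθ, integral_cos,
    Real.sinc_of_ne_zero (mul_ne_zero hθ ha)]
  simp
  field_simp

lemma limitCov_self (Fs ρ : ℝ) {K : ℕ} (t : Fin K → ℝ) (m n : Fin K) (c : Fin 2) :
    limitCov Fs ρ t (m, c) (n, c) = Rrr Fs ρ (t n - t m) := by
  simp_rw [limitCov, kernel_self]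
  have hi : ∀ a b, IntervalIntegrable
      (fun x => Real.cos (2 * Real.pi * Fs * (t n - t m) * x)) volume a b := fun a b =>
    (by fun_prop : Continuous _).intervalIntegrable a b
  -- Writing `∫_ρ^1` as `∫_0^1 - ∫_0^ρ` yields the two sinc terms, including the case of equal
  -- times.
  rw [← intervalIntegral.integral_interval_sub_left (hi 0 1) (hi 0 ρ), integral_zero_cos_mul,
    integral_zero_cos_mul, Rrr, nsinc, nsinc]
  ring_nf

lemma limitCov_zero_one (Fs ρ : ℝ) (hFs : 0 < Fs) {K : ℕ} (t : Fin K → ℝ) (m n : Fin K) :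
    limitCov Fs ρ t (m, 0) (n, 1) = Rri Fs ρ (t n - t m) := by
  simp_rw [limitCov, kernel_zero_one, Rri]
  split_ifs with h
  · simp [h]
  · have hθ : 2 * Real.pi * Fs * (t n - t m) ≠ 0 := by positivity
    rw [intervalIntegral.integral_comp_mul_left _ hθ, integral_sin, smul_eq_mul]
    ring_nf

/-! ### Moments of the data and almost sure convergence of the Gram matrices. -/

lemma sigmaB_pos {M : Finset ℂ} (hM0 : ∃ x ∈ M, x ≠ 0) : 0 < sigmaB M := by
  obtain ⟨x, hx, hx0⟩ := hM0
  have h1 : 0 < ∑ x ∈ M, ‖x‖ ^ 2 :=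
    Finset.sum_pos' (fun _ _ => by positivity) ⟨x, hx, by positivity⟩
  have h2 : 0 < M.card := Finset.card_pos.2 ⟨x, hx⟩
  exact Real.sqrt_pos.2 (by positivity)

lemma sigmaB_sq (M : Finset ℂ) : sigmaB M ^ 2 = (∑ x ∈ M, ‖x‖ ^ 2) / (M.card : ℝ) :=
  Real.sq_sqrt (by positivity)

/-- The second moments of an equiprobable symbol of a constellation with vanishing sum of
squares. -/
lemma integral_re_mul_re {M : Finset ℂ} (hM2 : ∑ x ∈ M, x ^ 2 = 0) (w z : ℂ) :
    ∫ x, (x * w).re * (x * z).re ∂(uniformOn (M : Set ℂ)) =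
      sigmaB M ^ 2 * (1 / 2 * ((starRingEnd ℂ) w * z).re) := by
  rw [integral_uniformOn_finset, sigmaB_sq]
  -- The product splits into a term in `x²`, which `hM2` annihilates, and a term in `|x|²`, which
  -- gives `σ_b²`.
  have h : ∀ x : ℂ, (x * w).re * (x * z).re =
      1 / 2 * (x ^ 2 * (w * z)).re + ‖x‖ ^ 2 * (1 / 2 * ((starRingEnd ℂ) w * z).re) := by
    intro x
    rw [← Complex.normSq_eq_norm_sq, Complex.normSq_apply, sq]
    simp
    ring
  simp_rw [h]
  rw [Finset.sum_add_distrib, ← Finset.mul_sum, ← Complex.re_sum, ← Finset.sum_mul, hM2,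
    ← Finset.sum_mul]
  simp
  ring

lemma ae_mem_of_hasLaw_uniformOn {Ω : Type*} [MeasurableSpace Ω] {P : Measure Ω} {M : Finset ℂ}
    (hM : M.Nonempty) {X : Ω → ℂ} (hX : HasLaw X (uniformOn (M : Set ℂ)) P) :
    ∀ᵐ ω ∂P, X ω ∈ M := by
  have hm : MeasurableSet (M : Set ℂ) := M.measurableSet
  have := isProbabilityMeasure_uniformOn M.finite_toSet hM
  have h : ∀ᵐ x ∂(uniformOn (M : Set ℂ)), x ∈ (M : Set ℂ) :=
    (prob_compl_eq_zero_iff hm).2 (uniformOn_self M.finite_toSet hM)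
  exact (hX.ae_iff (p := fun x => x ∈ (M : Set ℂ)) (measurableSet_setOfPred.1 hm)).2 h

lemma norm_le_sum_norm {M : Finset ℂ} {x : ℂ} (hx : x ∈ M) : ‖x‖ ≤ ∑ y ∈ M, ‖y‖ :=
  Finset.single_le_sum (f := fun y : ℂ => ‖y‖) (fun _ _ => norm_nonneg _) hx

lemma abs_re_mul_phasor_le {M : Finset ℂ} {b : ℂ} (hb : b ∈ M) (Fs t : ℝ) (c : Fin 2) (x : ℝ) :
    |(b * phasor Fs t c x).re| ≤ ∑ y ∈ M, ‖y‖ := by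
  refine (Complex.abs_re_le_norm _).trans ?_
  rw [norm_mul, norm_phasor, mul_one]
  exact norm_le_sum_norm hb

lemma abs_coeff_le {M : Finset ℂ} (Fs : ℝ) {N : ℕ} {b : Fin N → ℂ} (hb : ∀ k, b k ∈ M) (j : ℕ)
    {K : ℕ} (t : Fin K → ℝ) (p : Fin K × Fin 2) (k : Fin N) :
    |coeff M Fs b j t p k| ≤ ((∑ y ∈ M, ‖y‖) / sigmaB M) / √N := by
  have hσ : 0 ≤ sigmaB M := Real.sqrt_nonneg _
  rw [coeff, div_div]
  split_ifs
  · rw [abs_div, abs_of_nonneg (by positivity : 0 ≤ sigmaB M * √(N : ℝ))]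
    exact div_le_div_of_nonneg_right (abs_re_mul_phasor_le (hb k) _ _ _ _) (by positivity)
  · rw [abs_zero]
    have : 0 ≤ ∑ y ∈ M, ‖y‖ := Finset.sum_nonneg fun _ _ => norm_nonneg _
    positivity

/-- Almost surely, the Gram matrices of the coefficients of the signs converge. -/
theorem ae_tendsto_gram_coeff {Ω : Type*} [MeasurableSpace Ω] (P : Measure Ω)
    [IsProbabilityMeasure P] {M : Finset ℂ} (hM0 : ∃ x ∈ M, x ≠ 0) (hM2 : ∑ x ∈ M, x ^ 2 = 0)
    (Fs : ℝ) (B : (N : ℕ) → Fin N → Ω → ℂ)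
    (hBlaw : ∀ N k, HasLaw (B N k) (uniformOn (M : Set ℂ)) P) (hBind : ∀ N, iIndepFun (B N) P)
    {ρ : ℝ} (hρ1 : ρ ≤ 1) {j : ℕ → ℕ} (hj : Tendsto (fun N : ℕ => (j N : ℝ) / N) atTop (𝓝 ρ))
    {K : ℕ} (t : Fin K → ℝ) (p q : Fin K × Fin 2) :
    ∀ᵐ ω ∂P, Tendsto (fun N : ℕ => ∑ k, coeff M Fs (fun k => B N k ω) (j N) t p k
      * coeff M Fs (fun k => B N k ω) (j N) t q k) atTop (𝓝 (limitCov Fs ρ t p q)) := by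
  have hσ := sigmaB_pos hM0
  have hM : M.Nonempty := let ⟨x, hx, _⟩ := hM0; ⟨x, hx⟩
  have := isProbabilityMeasure_uniformOn M.finite_toSet hM
  set w : Fin K × Fin 2 → ℝ → ℂ := fun p => phasor Fs (t p.1) p.2 with hw
  -- The centred products of the coefficients, before division by `σ_b² N`; they are independent,
  -- bounded and vanish for `k ≤ j N`.
  set g : (N : ℕ) → Fin N → ℂ → ℝ := fun N k x =>
    if j N < k then (x * w p ((k : ℕ) / (N : ℝ))).re * (x * w q ((k : ℕ) / (N : ℝ))).re
      - sigmaB M ^ 2 * (1 / 2 * kernel Fs t p q ((k : ℕ) / (N : ℝ))) else 0 with hg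
  have hgm : ∀ N k, Measurable (g N k) := by
    intro N k
    simp only [hg]
    split_ifs
    · fun_prop
    · fun_prop
  have hg0 : ∀ N k, ∫ ω, g N k (B N k ω) ∂P = 0 := by
    intro N k
    have := (hBlaw N k).integral_comp (f := g N k) (hgm N k).aestronglyMeasurable
    rw [Function.comp_def] at this
    rw [this]
    simp only [hg]
    split_ifs
    · rw [integral_sub (integrable_uniformOn_finset M _) (integrable_const _),
        integral_re_mul_re hM2]
      simp [kernel, hw]
    · simp
  have hgb : ∀ N k, ∀ᵐ ω ∂P, |g N k (B N k ω)| ≤ (∑ y ∈ M, ‖y‖) ^ 2 + sigmaB M ^ 2 := by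
    intro N k
    filter_upwards [ae_mem_of_hasLaw_uniformOn hM (hBlaw N k)] with ω hω
    simp only [hg]
    split_ifs
    · refine (abs_sub _ _).trans (add_le_add ?_ ?_)
      · rw [abs_mul, sq]
        exact mul_le_mul (abs_re_mul_phasor_le hω _ _ _ _) (abs_re_mul_phasor_le hω _ _ _ _)
          (abs_nonneg _) (Finset.sum_nonneg fun _ _ => norm_nonneg _)
      · have hk : |kernel Fs t p q ((k : ℕ) / (N : ℝ))| ≤ 1 := by
          refine (Complex.abs_re_le_norm _).trans ?_
          rw [norm_mul, RCLike.norm_conj, norm_phasor, norm_phasor, one_mul]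
        rw [abs_mul, abs_mul, abs_of_nonneg (sq_nonneg _), abs_of_pos (by norm_num)]
        nlinarith [sq_nonneg (sigmaB M)]
    · simp only [abs_zero]; positivity
  obtain ⟨L, hL⟩ := exists_lipschitzWith_kernel Fs t p q
  have hR := (tendsto_riemann_sum_suffix hL hρ1 hj).const_mul (1 / 2)
  filter_upwards [ae_tendsto_average_triangular_array P (fun N k ω => g N k (B N k ω))
    (fun N => (hBind N).comp (fun k => g N k) (hgm N))
    (fun N k => (hgm N k).comp_aemeasurable (hBlaw N k).aemeasurable) _ hgb hg0] with ω hω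
  -- The centred average over `σ_b²` plus the Riemann sum is exactly the Gram sum.
  have h := (hω.const_mul (sigmaB M ^ 2)⁻¹).add hR
  rw [mul_zero, zero_add] at h
  refine h.congr fun N => ?_
  simp_rw [Finset.mul_sum]
  rw [← Finset.sum_add_distrib]
  refine Finset.sum_congr rfl fun k _ => ?_
  simp only [hg, coeff, hw]
  split_ifs
  · have hN : (0 : ℝ) < N := by exact_mod_cast (Nat.zero_le _).trans_lt k.2
    rw [div_mul_div_comm, mul_mul_mul_comm, Real.mul_self_sqrt hN.le]
    field_simp
    ring
  · simp

/-- Thanks to the floor this holds along all `N`, so convergence can be proved for the whole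
sequence and restricted to `alongIntegral ρ` at the end. -/
lemma tendsto_iter_div {ρ : ℚ} (hρ0 : 0 ≤ ρ) :
    Tendsto (fun N : ℕ => (iter ρ N : ℝ) / N) atTop (𝓝 (ρ : ℝ)) := by
  have h := (Rat.continuous_coe_real.tendsto ρ).comp
    ((tendsto_nat_floor_mul_div_atTop hρ0).comp tendsto_natCast_atTop_atTop)
  refine h.congr fun N => ?_
  simp [iter]

end OFDM

/-! ### The main theorem. -/

theorem theorem2 {Ω : Type*} [MeasurableSpace Ω] (P : Measure Ω) [IsProbabilityMeasure P]
    -- the constellation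
    (M : Finset ℂ) (hM0 : ∃ x ∈ M, x ≠ 0) (hM2 : ∑ x ∈ M, x ^ 2 = 0)
    (Fs : ℝ) (hFs : 0 < Fs)
    -- for every `N`, the data vector `B N` is uniformly distributed in `M ^ N`
    (B : (N : ℕ) → Fin N → Ω → ℂ)
    (hBlaw : ∀ N k, HasLaw (B N k) (uniformOn (M : Set ℂ)) P)
    (hBind : ∀ N, iIndepFun (B N) P)
    (ρ : ℚ) (hρ0 : 0 ≤ ρ) (hρ1 : ρ ≤ 1)
    -- the time instances
    (K : ℕ) (t : Fin K → ℝ) (ht : ∀ m, 0 ≤ t m) :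
    ∃ ν : ProbabilityMeasure (EuclideanSpace ℝ (Fin K × Fin 2)),
      -- the limit vector `[x_1, y_1, …, x_K, y_K]` is centred, jointly Gaussian
      IsGaussian (ν : Measure (EuclideanSpace ℝ (Fin K × Fin 2))) ∧
      (∀ p, ∫ z, z p ∂(ν : Measure (EuclideanSpace ℝ (Fin K × Fin 2))) = 0) ∧
      (∀ m n, ∫ z, z (m, 0) * z (n, 0) ∂(ν : Measure (EuclideanSpace ℝ (Fin K × Fin 2)))
        = OFDM.Rrr Fs ρ (t n - t m)) ∧
      (∀ m n, ∫ z, z (m, 1) * z (n, 1) ∂(ν : Measure (EuclideanSpace ℝ (Fin K × Fin 2)))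
        = OFDM.Rrr Fs ρ (t n - t m)) ∧
      (∀ m n, ∫ z, z (m, 0) * z (n, 1) ∂(ν : Measure (EuclideanSpace ℝ (Fin K × Fin 2)))
        = OFDM.Rri Fs ρ (t n - t m)) ∧
      -- with probability one in the data, for all decided signs `d` and trial sign `s = ±1`
      ∀ᵐ ω ∂P, ∀ d : (N : ℕ) → Fin N → ℝ, (∀ N k, d N k = 1 ∨ d N k = -1) →
        ∀ s : ℝ, (s = 1 ∨ s = -1) →
          -- the covariances with respect to the random signs converge to `R_rr, R_ii, R_ri`
          (∀ m n, Tendsto (fun N : ℕ => ∫ X,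
              OFDM.uHatRe M Fs (fun k => B N k ω) (OFDM.iter ρ N) s (d N) (t m) X
                * OFDM.uHatRe M Fs (fun k => B N k ω) (OFDM.iter ρ N) s (d N) (t n) X
              ∂(OFDM.signLaw N))
            (OFDM.alongIntegral ρ) (𝓝 (OFDM.Rrr Fs ρ (t n - t m)))) ∧
          (∀ m n, Tendsto (fun N : ℕ => ∫ X,
              OFDM.uHatIm M Fs (fun k => B N k ω) (OFDM.iter ρ N) s (d N) (t m) X
                * OFDM.uHatIm M Fs (fun k => B N k ω) (OFDM.iter ρ N) s (d N) (t n) X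
              ∂(OFDM.signLaw N))
            (OFDM.alongIntegral ρ) (𝓝 (OFDM.Rrr Fs ρ (t n - t m)))) ∧
          (∀ m n, Tendsto (fun N : ℕ => ∫ X,
              OFDM.uHatRe M Fs (fun k => B N k ω) (OFDM.iter ρ N) s (d N) (t m) X
                * OFDM.uHatIm M Fs (fun k => B N k ω) (OFDM.iter ρ N) s (d N) (t n) X
              ∂(OFDM.signLaw N))
            (OFDM.alongIntegral ρ) (𝓝 (OFDM.Rri Fs ρ (t n - t m)))) ∧
          -- and the vector converges in distribution
          TendstoInDistribution
            (fun (N : ℕ) (X : Fin N → ℝ) =>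
              OFDM.uHatVec M Fs (fun k => B N k ω) (OFDM.iter ρ N) s (d N) t X)
            (OFDM.alongIntegral ρ)
            (id : EuclideanSpace ℝ (Fin K × Fin 2) → EuclideanSpace ℝ (Fin K × Fin 2))
            (fun N => OFDM.signLaw N)
            (ν : Measure (EuclideanSpace ℝ (Fin K × Fin 2))) := by
  have hM : M.Nonempty := let ⟨x, hx, _⟩ := hM0; ⟨x, hx⟩
  have hgram := ae_all_iff.2 fun p => ae_all_iff.2 fun q =>
    OFDM.ae_tendsto_gram_coeff P hM0 hM2 Fs B hBlaw hBind (by exact_mod_cast hρ1)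
      (OFDM.tendsto_iter_div hρ0) t p q
  have hmem : ∀ᵐ ω ∂P, ∀ N k, B N k ω ∈ M := ae_all_iff.2 fun N => ae_all_iff.2 fun k =>
    OFDM.ae_mem_of_hasLaw_uniformOn hM (hBlaw N k)
  have hpos : (OFDM.limitCov Fs ρ t).PosSemidef := by
    -- The limit does not depend on the data, so a single good sample point gives positive
    -- semidefiniteness.
    obtain ⟨ω, hω⟩ := hgram.exists
    exact posSemidef_of_tendsto_gram hω
  refine ⟨⟨multivariateGaussian 0 (OFDM.limitCov Fs ρ t),
      isGaussian_multivariateGaussian.toIsProbabilityMeasure⟩,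
    isGaussian_multivariateGaussian, integral_eval_multivariateGaussian_zero _,
    fun m n => ?_, fun m n => ?_, fun m n => ?_, ?_⟩
  · exact (integral_eval_mul_eval_multivariateGaussian_zero hpos _ _).trans
      (OFDM.limitCov_self _ _ _ _ _ _)
  · exact (integral_eval_mul_eval_multivariateGaussian_zero hpos _ _).trans
      (OFDM.limitCov_self _ _ _ _ _ _)
  · exact (integral_eval_mul_eval_multivariateGaussian_zero hpos _ _).trans
      (OFDM.limitCov_zero_one _ _ hFs _ _ _)
  -- The null set is fixed before `d` and `s` are chosen: neither enters the coefficients.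
  filter_upwards [hgram, hmem] with ω hω hωM d _ s _
  have hle : OFDM.alongIntegral ρ ≤ atTop := inf_le_left
  simp_rw [OFDM.uHatRe_eq, OFDM.uHatIm_eq, OFDM.integral_signLaw_linear_mul_linear]
  refine ⟨fun m n => ?_, fun m n => ?_, fun m n => ?_, ?_⟩
  · rw [← OFDM.limitCov_self _ _ _ _ _ 0]
    exact (hω _ _).mono_left hle
  · rw [← OFDM.limitCov_self _ _ _ _ _ 1]
    exact (hω _ _).mono_left hle
  · rw [← OFDM.limitCov_zero_one _ _ hFs]
    exact (hω _ _).mono_left hle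
  · exact tendstoInDistribution_linear_forms_signLaw hle
      (fun N p k => OFDM.abs_coeff_le Fs (hωM N) (OFDM.iter ρ N) t p k) hω
      (fun N X => OFDM.uHatVec M Fs (fun k => B N k ω) (OFDM.iter ρ N) s (d N) t X)
      (fun N X p => OFDM.uHatVec_apply M Fs _ _ s (d N) t X p)
      (fun N => OFDM.measurable_uHatVec M Fs _ _ s (d N) t)
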